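/- Let $\mathbb F_4=\mathbb F_2(g)$ be the field with four elements, where $g^2=g+1$, and for integers $b,c,d\ge 0$ put $$f_{b,c,d}=(x+1)^b(x+g)^c(x+g^2)^d\in\mathbb F_4[x].$$ Say that a polynomial $f\neq 0$ has no zero coefficient if the coefficient of $x^k$ in $f$ is nonzero for every $0\le k\le\deg f$. 1. If $f=f_{b,c,d}$ has no zero coefficient, then the base-4 expansion of $\deg f+1$ has at most $4$ nonzero digits. 2. The bound is attained: $f_{28,35,37}=(x+1)^{28}(x+g)^{35}(x+g^2)^{37}$ has degree $100$, has no zero coefficient, and $101=1+1\cdot 4+2\cdot 4^2+1\cdot 4^3$ has exactly $4$ nonzero digits in base $4$. 3. The set of all $n=b+c+d+1$ such that $f_{b,c,d}$ has no zero coefficient is recognised by the following finite automaton, which reads the base-4 digits of $n$ starting with the least significant one (zeros after the most significant nonzero digit are allowed). It has the states $0,1,2,3,4,5$; the initial state is $0$, the accepting states are $1,2,3,4$, and the successors of each state on the digits $0,1,2,3$, in this order, are $$0\mapsto(0,1,1,2),\quad 1\mapsto(1,2,2,4),\quad 2\mapsto(2,3,4,3),\quad 3\mapsto(3,5,5,5),\quad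 4\mapsto(3,3,5,5),\quad 5\mapsto(5,5,5,5).$$ That is, a word $w$ over $\{0,1,2,3\}$ is accepted if and only if the number $n$ that it represents is equal to $b+c+d+1$ for some $b,c,d\ge 0$ such that $f_{b,c,d}$ has no zero coefficient. -/

import Mathlib

open Polynomial

/-- All coefficients of `f`, from the constant one up to the leading one, are nonzero. -/
def NoZeroCoeff {K : Type*} [Field K] (f : K[X]) : Prop :=
  ∀ k ≤ f.natDegree, f.coeff k ≠ 0

/-- The polynomial `(x + 1)^b (x + g)^c (x + g²)^d`. -/
noncomputable def linProd {K : Type*} [Field K] (g : K) (b c d : ℕ) : K[X] :=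
  (X + 1) ^ b * (X + C g) ^ c * (X + C (g ^ 2)) ^ d

/-- The number of nonzero digits in the base `q` expansion of `n`. -/
def nonzeroDigitCount (q n : ℕ) : ℕ :=
  (Nat.digits q n).countP (fun a => a ≠ 0)

/-- The natural number with base 4 digits `w`, least significant digit first
(zeros may follow the most significant nonzero digit). -/
def lsd4Value (w : List (Fin 4)) : ℕ :=
  Nat.ofDigits 4 (w.map Fin.val)

/-- The automaton `co4no0`, reading base 4 digits, least significant digit first.
Row `s` lists the successors of state `s` on the digits `0, 1, 2, 3`; state `0` is initial,
the states `1, 2, 3, 4` are accepting, and state `5` is the dead state. -/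
def co4no0 : DFA (Fin 4) (Fin 6) where
  step s a :=
    (![![0, 1, 1, 2],
       ![1, 2, 2, 4],
       ![2, 3, 4, 3],
       ![3, 5, 5, 5],
       ![3, 3, 5, 5],
       ![5, 5, 5, 5]] : Fin 6 → Fin 4 → Fin 6) s a
  start := 0
  accept := {1, 2, 3, 4}

/-!
Since `K` has four elements, `f(x)⁴ = f(x⁴)` for every `f ∈ K[x]`. Hence, if `b₀, c₀, d₀` are the
last base 4 digits of `4b + b₀`, `4c + c₀`, `4d + d₀`, then
`h · f_{4b+b₀,4c+c₀,4d+d₀} = (h · f_{b₀,c₀,d₀})(x) · f_{b,c,d}(x⁴)`. Splitting `h · f_{b₀,c₀,d₀}`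
as `∑ xʳ hᵣ(x⁴)` with `r < 4`, one sees that the left side has no zero coefficient if and only if
`hᵣ · f_{b,c,d}` has none for all four `r` (`good_sections_iff`). Starting with the condition
`h = 1`, reading the digits of `(b, c, d)` therefore transforms one finite set of conditions `h`
into another.

Up to scalars, the only sets of conditions that can be met are `{1} ∪ {1 + αx | α ∈ U}` for the
eight sets `U` of nonzero scalars, and a terminal one which forces all remaining digits to vanish.
All others that arise contain an `h` with vanishing constant term. The carry in the addition `b + c + d + 1`
is `1` in the former sets and `0` in the terminal one. The state of the automaton `co4no0` tells
the size of `U`: the states `0, 1, 2, 4` stand for `|U| = 0, 1, 2, 3`. The lemma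
`configuration_closed` states that every transition is of this form and agrees with the automaton,
so that each `n` that occurs is accepted; `exists_digits_of_step` and `exists_digits_of_last`
provide enough transitions to realise every accepted word. These are finite verifications over
coefficient lists with entries in a coded field of four elements.

Finally, the number of nonzero digits that can still be read before reaching the dead state
decreases along the automaton from `4` at the initial state; this is the bound.
-/

namespace Co4

/-! ### A coded field of four elements -/

/-- Codes for the elements of the field with four elements: `(s, t)` stands for `s + t g`, where
`true` is read as `1` and `false` as `0`. -/
abbrev Code := Bool × Bool

namespace Code

/-- The code of `0`. -/
abbrev zero : Code := (false, false)

/-- The code of `1`. -/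
abbrev one : Code := (true, false)

/-- The code of `g`. -/
abbrev gen : Code := (false, true)

/-- The code of `g² = g + 1`. -/
abbrev genSq : Code := (true, true)

/-- The nonzero elements. -/
def units : List Code := [one, gen, genSq]

/-- Addition on codes. -/
def add (a b : Code) : Code := (xor a.1 b.1, xor a.2 b.2)

/-- Multiplication on codes, from `g² = g + 1`. -/
def mul (a b : Code) : Code :=
  (xor (a.1 && b.1) (a.2 && b.2), xor (xor (a.1 && b.2) (a.2 && b.1)) (a.2 && b.2))

/-- The element of `K` with a given code. -/
def toField {K : Type*} [Field K] (g : K) (a : Code) : K :=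
  (if a.1 then 1 else 0) + (if a.2 then g else 0)

variable {K : Type*} [Field K] {g : K}

@[simp] lemma toField_zero : toField g zero = 0 := by simp [toField]

lemma toField_add (h2 : (2 : K) = 0) (a b : Code) : toField g (add a b) = toField g a + toField g b := by
  obtain ⟨a₁, a₂⟩ := a
  obtain ⟨b₁, b₂⟩ := b
  cases a₁ <;> cases a₂ <;> cases b₁ <;> cases b₂ <;> simp [toField, add] <;> grind

lemma toField_mul (h2 : (2 : K) = 0) (hg : g ^ 2 = g + 1) (a b : Code) :
    toField g (mul a b) = toField g a * toField g b := by
  obtain ⟨a₁, a₂⟩ := a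
  obtain ⟨b₁, b₂⟩ := b
  cases a₁ <;> cases a₂ <;> cases b₁ <;> cases b₂ <;> simp [toField, mul] <;> grind

lemma toField_eq_zero_iff (hg : g ^ 2 = g + 1) (a : Code) : toField g a = 0 ↔ a = zero := by
  refine ⟨fun h => ?_, fun h => by simp [h]⟩
  obtain ⟨a₁, a₂⟩ := a
  cases a₁ <;> cases a₂ <;> simp [toField] at h ⊢ <;> grind

end Code

/-! ### Polynomials as lists of coefficients -/

open Code

/-- The polynomial with a given list of coefficients, constant term first. Lists may end in zeros:
the length of a list is part of the data. -/
noncomputable def toPoly {K : Type*} [Field K] (g : K) : List Code → K[X]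
  | [] => 0
  | a :: l => C (toField g a) + X * toPoly g l

/-- The coefficients of `p + (x + α) l(x)`. -/
def addMulLin (α : Code) : Code → List Code → List Code
  | p, [] => [p]
  | p, a :: l => add p (mul α a) :: addMulLin α a l

/-- The coefficients of `l(x) (x + 1)^b (x + g)^c (x + g²)^d`. -/
def mulLinProd (l : List Code) (b c d : ℕ) : List Code :=
  (addMulLin one zero)^[b] ((addMulLin gen zero)^[c] ((addMulLin genSq zero)^[d] l))

/-- The entries at the positions `r, r + 4, r + 8, …`. -/
def section4 : List Code → ℕ → List Code
  | [], _ => []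
  | a :: l, 0 => a :: section4 l 3
  | _ :: l, r + 1 => section4 l r

@[simp] lemma length_addMulLin (α p : Code) (l : List Code) :
    (addMulLin α p l).length = l.length + 1 := by
  induction l generalizing p with
  | nil => rfl
  | cons a l ih => simp [addMulLin, ih]

lemma length_iterate_addMulLin (α p : Code) (n : ℕ) (l : List Code) :
    ((addMulLin α p)^[n] l).length = l.length + n := by
  induction n generalizing l with
  | zero => rfl
  | succ n ih => rw [Function.iterate_succ_apply, ih, length_addMulLin]; omega

lemma length_mulLinProd (l : List Code) (b c d : ℕ) :
    (mulLinProd l b c d).length = l.length + (b + c + d) := by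
  simp only [mulLinProd, length_iterate_addMulLin]; omega

lemma length_section4 (l : List Code) (r : ℕ) (hr : r < 4) :
    (section4 l r).length = (l.length + 3 - r) / 4 := by
  induction l generalizing r with
  | nil => simp [section4]; omega
  | cons a l ih =>
    cases r with
    | zero => simp only [section4, List.length_cons, ih 3 (by omega)]; omega
    | succ r => simp only [section4, ih r (by omega), List.length_cons]; congr 1; omega

section

variable {K : Type*} [Field K] {g : K}

lemma toPoly_addMulLin (h2 : (2 : K) = 0) (hg : g ^ 2 = g + 1) (α p : Code) (l : List Code) :
    toPoly g (addMulLin α p l) = C (toField g p) + (X + C (toField g α)) * toPoly g l := by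
  induction l generalizing p with
  | nil => simp [addMulLin, toPoly]
  | cons a l ih =>
    simp only [addMulLin, toPoly, ih, toField_add h2, toField_mul h2 hg, C_add, C_mul]
    ring

lemma toPoly_iterate_addMulLin (h2 : (2 : K) = 0) (hg : g ^ 2 = g + 1) (α : Code) (n : ℕ)
    (l : List Code) :
    toPoly g ((addMulLin α zero)^[n] l) = (X + C (toField g α)) ^ n * toPoly g l := by
  induction n generalizing l with
  | zero => simp
  | succ n ih =>
    rw [Function.iterate_succ_apply, ih, toPoly_addMulLin h2 hg, toField_zero, C_0, pow_succ]
    ring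

lemma toPoly_mulLinProd (h2 : (2 : K) = 0) (hg : g ^ 2 = g + 1) (l : List Code) (b c d : ℕ) :
    toPoly g (mulLinProd l b c d) = toPoly g l * linProd g b c d := by
  have h1 : toField g one = 1 := by simp [toField]
  have h3 : toField g gen = g := by simp [toField]
  have h4 : toField g genSq = g ^ 2 := by simp [toField, hg, add_comm g]
  simp only [mulLinProd, toPoly_iterate_addMulLin h2 hg, linProd, h1, h3, h4, C_1]
  ring

lemma toPoly_map_mul (h2 : (2 : K) = 0) (hg : g ^ 2 = g + 1) (u : Code) (l : List Code) :
    toPoly g (l.map (mul u)) = C (toField g u) * toPoly g l := by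
  induction l with
  | nil => simp [toPoly]
  | cons a l ih => simp only [List.map_cons, toPoly, ih, toField_mul h2 hg, C_mul]; ring

lemma coeff_toPoly_ne_zero (hg : g ^ 2 = g + 1) {l : List Code} (hl : zero ∉ l) :
    ∀ k < l.length, (toPoly g l).coeff k ≠ 0 := by
  induction l with
  | nil => simp
  | cons a l ih =>
    rw [List.mem_cons, not_or] at hl
    rintro (_ | k) hk
    · simpa [toPoly, toField_eq_zero_iff hg] using fun h => hl.1 h.symm
    · simpa [toPoly, coeff_C_succ] using ih hl.2 k (by simpa using hk)

/-- The coefficients of `l(x) f(x⁴)` in degrees congruent to `r` modulo `4` are the coefficients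
of the product of the `r`-th section of `l` with `f`. -/
lemma coeff_toPoly_mul_expand (l : List Code) (f : K[X]) (j r : ℕ) (hr : r < 4) :
    (toPoly g l * expand K 4 f).coeff (4 * j + r) = (toPoly g (section4 l r) * f).coeff j := by
  induction l generalizing j r with
  | nil => simp [toPoly, section4]
  | cons a l ih =>
    cases r with
    | zero =>
      simp only [toPoly, section4, add_mul, mul_assoc, coeff_add, coeff_C_mul]
      congr 1
      · rw [add_zero, coeff_expand_mul' (by norm_num)]
      · cases j with
        | zero => simp
        | succ j =>
          rw [show 4 * (j + 1) + 0 = (4 * j + 3) + 1 by ring, coeff_X_mul, coeff_X_mul,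
            ih j 3 (by norm_num)]
    | succ r =>
      rw [toPoly, section4, add_mul, mul_assoc, coeff_add, coeff_C_mul, coeff_expand (by norm_num),
        if_neg (by omega), ← add_assoc, coeff_X_mul, ih j r (by omega)]
      simp

/-! ### Sets of conditions and their sections -/

/-- For every `h` in `S`, the product `h · (x + 1)^b (x + g)^c (x + g²)^d` has no zero coefficient,
where the degree of `h` is understood to be one less than the length of the list. In particular
`h = []`, the zero polynomial of degree `-1`, imposes the condition `b = c = d = 0`. -/
def Good (g : K) (S : List (List Code)) (b c d : ℕ) : Prop :=
  ∀ h ∈ S, ∀ k < h.length + (b + c + d), (toPoly g h * linProd g b c d).coeff k ≠ 0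

end

/-- The sections of `h · (x + 1)^b (x + g)^c (x + g²)^d` for all `h` in `S`. -/
def sections (S : List (List Code)) (b c d : ℕ) : List (List Code) :=
  S.flatMap fun h => (List.range 4).map (section4 (mulLinProd h b c d))

/-- Every member of `T` has a nonzero scalar multiple in `S`. -/
def Covers (S T : List (List Code)) : Prop :=
  ∀ h ∈ T, ∃ u ∈ units, h.map (mul u) ∈ S

instance (S T : List (List Code)) : Decidable (Covers S T) := by unfold Covers; infer_instance

section

variable {K : Type*} [Field K] {g : K}

lemma two_eq_zero_of_card (hK : Nat.card K = 4) : (2 : K) = 0 := by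
  have : Finite K := Nat.finite_of_card_ne_zero (by simp [hK])
  have := Fintype.ofFinite K
  have h := FiniteField.cast_card_eq_zero K
  rw [← Nat.card_eq_fintype_card, hK] at h
  have h' : (2 : K) * 2 = 0 := by rw [← h]; norm_num
  simpa using h'

lemma expand_eq_pow_four (hK : Nat.card K = 4) (f : K[X]) : expand K 4 f = f ^ 4 := by
  have : Finite K := Nat.finite_of_card_ne_zero (by simp [hK])
  have := Fintype.ofFinite K
  have h := FiniteField.expand_card f
  rwa [← Nat.card_eq_fintype_card, hK] at h

lemma linProd_four_mul_add (hK : Nat.card K = 4) (b c d b₀ c₀ d₀ : ℕ) :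
    linProd g (4 * b + b₀) (4 * c + c₀) (4 * d + d₀) =
      linProd g b₀ c₀ d₀ * expand K 4 (linProd g b c d) := by
  rw [expand_eq_pow_four hK]
  simp only [linProd, pow_add, pow_mul, mul_pow, pow_right_comm _ 4]
  ring

/-- Reading the last base 4 digits of the exponents replaces a set of conditions by its
sections. -/
lemma good_sections_iff (hK : Nat.card K = 4) (hg : g ^ 2 = g + 1) (S : List (List Code))
    (b c d b₀ c₀ d₀ : ℕ) :
    Good g S (4 * b + b₀) (4 * c + c₀) (4 * d + d₀) ↔ Good g (sections S b₀ c₀ d₀) b c d := by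
  have h2 := two_eq_zero_of_card hK
  simp only [Good, sections, List.mem_flatMap, List.mem_map, List.mem_range]
  have key (h : List Code) : toPoly g h * linProd g (4 * b + b₀) (4 * c + c₀) (4 * d + d₀) =
      toPoly g (mulLinProd h b₀ c₀ d₀) * expand K 4 (linProd g b c d) := by
    rw [linProd_four_mul_add hK, toPoly_mulLinProd h2 hg, mul_assoc]
  constructor
  · rintro H _ ⟨h, hS, r, hr, rfl⟩ j hj
    rw [length_section4 _ _ hr, length_mulLinProd] at hj
    have := H h hS (4 * j + r) (by omega)
    rwa [key, coeff_toPoly_mul_expand _ _ _ _ hr] at this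
  · intro H h hS k hk
    have hr : k % 4 < 4 := Nat.mod_lt _ (by norm_num)
    have := H _ ⟨h, hS, k % 4, hr, rfl⟩ (k / 4)
      (by rw [length_section4 _ _ hr, length_mulLinProd]; omega)
    rwa [← coeff_toPoly_mul_expand _ _ _ _ hr, Nat.div_add_mod, ← key] at this

lemma Good.of_covers (h2 : (2 : K) = 0) (hg : g ^ 2 = g + 1) {S T : List (List Code)} {b c d : ℕ}
    (hS : Good g S b c d) (hST : Covers S T) : Good g T b c d := by
  intro h hT k hk
  obtain ⟨u, -, hu⟩ := hST h hT
  have := hS _ hu k (by simpa using hk)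
  rw [toPoly_map_mul h2 hg, mul_assoc, coeff_C_mul] at this
  exact right_ne_zero_of_mul this

/-- A condition `h` with vanishing constant term cannot be met. -/
lemma Good.head_ne_zero {S : List (List Code)} {b c d : ℕ} (hS : Good g S b c d) :
    ∀ h ∈ S, h.head? ≠ some zero := by
  rintro (_ | ⟨a, h⟩) hh hz
  · simp at hz
  · obtain rfl : a = zero := by simpa using hz
    exact hS _ hh 0 (by simp) (by simp [toPoly, mul_coeff_zero])

/-- For given exponents, the conditions can be tested by expanding the products. -/
lemma good_of_forall_notMem (h2 : (2 : K) = 0) (hg : g ^ 2 = g + 1) {S : List (List Code)}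
    {b c d : ℕ} (hS : ∀ h ∈ S, zero ∉ mulLinProd h b c d) : Good g S b c d := by
  intro h hh k hk
  rw [← toPoly_mulLinProd h2 hg]
  exact coeff_toPoly_ne_zero hg (hS h hh) k (by rwa [length_mulLinProd])

lemma natDegree_linProd (g : K) (b c d : ℕ) : (linProd g b c d).natDegree = b + c + d := by
  have hlin (a : K) (n : ℕ) : ((X + C a) ^ n).Monic := (monic_X_add_C a).pow n
  have hdeg (a : K) (n : ℕ) : ((X + C a) ^ n).natDegree = n := by
    rw [natDegree_pow, natDegree_X_add_C, mul_one]
  rw [linProd, ← C_1, ((hlin _ b).mul (hlin _ c)).natDegree_mul (hlin _ d),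
    (hlin _ b).natDegree_mul (hlin _ c), hdeg, hdeg, hdeg]

lemma noZeroCoeff_linProd_iff (g : K) (b c d : ℕ) :
    NoZeroCoeff (linProd g b c d) ↔ Good g [[one]] b c d := by
  simp [NoZeroCoeff, Good, natDegree_linProd, toPoly, toField, add_comm 1]

end

/-! ### The transitions between sets of conditions -/

/-- The set of conditions `{1} ∪ {1 + αx | α ∈ U}`. -/
def lines (U : List Code) : List (List Code) := [one] :: U.map fun α => [one, α]

/-- The state of `co4no0` that stands for the sets `U` with `k` elements. -/
def stateOfCard (k : ℕ) : Fin 6 := if k = 3 then 4 else Fin.ofNat 6 k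

/-- The sets of conditions which can be met, each with the carry in the computation of
`b + c + d + 1` and a state of `co4no0` in which it occurs. -/
def configurations : List (List (List Code) × ℕ × Fin 6) :=
  units.sublists.map (fun U => (lines U, 1, stateOfCard U.length)) ++
    [1, 2, 3, 4].map fun q => ([[], [one]], 0, q)

/-- The sections of the conditions in a configuration either cannot be met or contain those of the
configuration which the automaton and the addition of digits with carry lead to. -/
lemma configuration_closed : ∀ s ∈ configurations, ∀ b c d : Fin 4,
    (∃ h ∈ sections s.1 b c d, h.head? = some zero) ∨
      ∃ s' ∈ configurations, Covers (sections s.1 b c d) s'.1 ∧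
        s'.2.1 = (b + c + d + s.2.1 : ℕ) / 4 ∧
        s'.2.2 = co4no0.step s.2.2 (Fin.ofNat 4 (b + c + d + s.2.1)) := by
  decide +kernel

/-- Digits leading from a set `U` to a set `U'` of the size prescribed by the automaton. The states
`3` and `5` are left out, as they accept no word with a nonzero value. -/
lemma exists_digits_of_step : ∀ U ∈ units.sublists, ∀ a : Fin 4,
    co4no0.step (stateOfCard U.length) a ≠ 3 → co4no0.step (stateOfCard U.length) a ≠ 5 →
      ∃ U' ∈ units.sublists, stateOfCard U'.length = co4no0.step (stateOfCard U.length) a ∧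
        ∃ b c d : Fin 4, (b + c + d + 1 : ℕ) = 4 + a ∧
          Covers (lines U') (sections (lines U) b c d) := by
  decide +kernel

/-- Exponents for the case that `a` is the last nonzero digit. -/
lemma exists_digits_of_last : ∀ U ∈ units.sublists, ∀ a : Fin 4, a ≠ 0 →
    co4no0.step (stateOfCard U.length) a ≠ 5 →
      ∃ b c d : Fin 4, (b + c + d + 1 : ℕ) = a ∧
        ∀ h ∈ lines U, zero ∉ mulLinProd h b c d := by
  decide +kernel

/-! ### The automaton -/

lemma lsd4Value_cons (a : Fin 4) (w : List (Fin 4)) :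
    lsd4Value (a :: w) = a + 4 * lsd4Value w := by
  simp [lsd4Value, Nat.ofDigits_cons]

lemma notMem_acceptsFrom_dead (w : List (Fin 4)) : w ∉ co4no0.acceptsFrom 5 := by
  induction w with
  | nil => simp [DFA.mem_acceptsFrom, co4no0]
  | cons a w ih =>
    have h : co4no0.step 5 a = 5 := by revert a; decide
    rwa [DFA.mem_acceptsFrom, DFA.evalFrom_cons, h]

lemma mem_acceptsFrom_cons {q : Fin 6} {a : Fin 4} {w : List (Fin 4)} :
    a :: w ∈ co4no0.acceptsFrom q ↔ w ∈ co4no0.acceptsFrom (co4no0.step q a) := by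
  simp [DFA.mem_acceptsFrom, DFA.evalFrom_cons]

/-- The number of nonzero digits that can be read from a given state without reaching the dead
state. -/
def digitBound : Fin 6 → ℕ := ![4, 3, 2, 0, 1, 0]

/-- A word accepted from a state has at most as many nonzero digits as the state allows. -/
lemma countP_le_digitBound {q : Fin 6} {w : List (Fin 4)} (hw : w ∈ co4no0.acceptsFrom q) :
    w.countP (fun a => a ≠ 0) ≤ digitBound q := by
  induction w generalizing q with
  | nil => simp
  | cons a w ih =>
    rw [mem_acceptsFrom_cons] at hw
    have key : ∀ q a, co4no0.step q a ≠ 5 →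
        digitBound (co4no0.step q a) + (if a ≠ 0 then 1 else 0) ≤ digitBound q := by decide
    have h5 : co4no0.step q a ≠ 5 := fun h => notMem_acceptsFrom_dead w (h ▸ hw)
    have := key q a h5
    have := ih hw
    rw [List.countP_cons]
    simp only [decide_eq_true_eq] at *
    omega

lemma lsd4Value_eq_zero_of_countP {w : List (Fin 4)} (hw : w.countP (fun a => a ≠ 0) = 0) :
    lsd4Value w = 0 := by
  induction w with
  | nil => rfl
  | cons a w ih =>
    rw [List.countP_cons] at hw
    have ha : a = 0 := by by_contra h; simp [h] at hw
    rw [lsd4Value_cons, ih (by omega), ha]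
    rfl

/-- Soundness: the numbers arising from a configuration are accepted from its state. -/
lemma mem_acceptsFrom_of_good {K : Type*} [Field K] {g : K} (hK : Nat.card K = 4)
    (hg : g ^ 2 = g + 1) (w : List (Fin 4)) :
    ∀ s ∈ configurations, ∀ b c d : ℕ, Good g s.1 b c d → b + c + d + s.2.1 = lsd4Value w →
      w ∈ co4no0.acceptsFrom s.2.2 := by
  induction w with
  | nil =>
    intro s hs b c d _ hw
    have key : ∀ s ∈ configurations, s.2.1 = 0 → s.2.2 ∈ ({1, 2, 3, 4} : Finset (Fin 6)) := by
      decide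
    have h0 : s.2.1 = 0 := by simp [lsd4Value] at hw; omega
    simpa [DFA.mem_acceptsFrom, co4no0] using key s hs h0
  | cons a w ih =>
    intro s hs b c d hS hw
    rw [lsd4Value_cons] at hw
    have hlt (n : ℕ) : n % 4 < 4 := Nat.mod_lt _ (by norm_num)
    have hS' := (good_sections_iff hK hg s.1 (b / 4) (c / 4) (d / 4) (b % 4) (c % 4) (d % 4)).1
      (by simpa only [Nat.div_add_mod] using hS)
    obtain ⟨h, hh, hz⟩ | ⟨s', hs', hcov, hcarry, hstate⟩ :=
      configuration_closed s hs ⟨b % 4, hlt b⟩ ⟨c % 4, hlt c⟩ ⟨d % 4, hlt d⟩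
    · exact absurd hz (hS'.head_ne_zero h hh)
    · simp only at hcarry hstate hcov
      have ha : Fin.ofNat 4 (b % 4 + c % 4 + d % 4 + s.2.1) = a := by
        ext; simp only [Fin.ofNat]; have := a.isLt; omega
      rw [ha] at hstate
      rw [mem_acceptsFrom_cons, ← hstate]
      refine ih s' hs' _ _ _ (hS'.of_covers (two_eq_zero_of_card hK) hg hcov) ?_
      have := a.isLt
      omega

/-- Completeness: a word with nonzero value that is accepted from the state of `U` arises from
exponents meeting the conditions `lines U`. -/
lemma exists_good_of_mem_acceptsFrom {K : Type*} [Field K] {g : K} (hK : Nat.card K = 4)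
    (hg : g ^ 2 = g + 1) (w : List (Fin 4)) (hpos : lsd4Value w ≠ 0) :
    ∀ U ∈ units.sublists, w ∈ co4no0.acceptsFrom (stateOfCard U.length) →
      ∃ b c d : ℕ, b + c + d + 1 = lsd4Value w ∧ Good g (lines U) b c d := by
  have h2 := two_eq_zero_of_card hK
  induction w with
  | nil => exact absurd rfl hpos
  | cons a w ih =>
    intro U hU hw
    rw [mem_acceptsFrom_cons] at hw
    rw [lsd4Value_cons] at hpos ⊢
    have h5 : co4no0.step (stateOfCard U.length) a ≠ 5 :=
      fun h => notMem_acceptsFrom_dead w (h ▸ hw)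
    by_cases hw0 : lsd4Value w = 0
    · obtain ⟨b, c, d, hsum, hgood⟩ :=
        exists_digits_of_last U hU a (by rintro rfl; simp [hw0] at hpos) h5
      exact ⟨b, c, d, by omega, good_of_forall_notMem h2 hg hgood⟩
    · have h3 : co4no0.step (stateOfCard U.length) a ≠ 3 := by
        intro h
        rw [h] at hw
        exact hw0 (lsd4Value_eq_zero_of_countP (Nat.le_zero.1 (countP_le_digitBound hw)))
      obtain ⟨U', hU', hstate, b₀, c₀, d₀, hsum, hcov⟩ := exists_digits_of_step U hU a h3 h5
      obtain ⟨b, c, d, hn, hgood⟩ := ih hw0 U' hU' (hstate ▸ hw)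
      exact ⟨4 * b + b₀, 4 * c + c₀, 4 * d + d₀, by omega,
        (good_sections_iff hK hg _ _ _ _ _ _ _).2 (hgood.of_covers h2 hg hcov)⟩

lemma notMem_accepts_of_lsd4Value_eq_zero {w : List (Fin 4)} (hw : lsd4Value w = 0) :
    w ∉ co4no0.accepts := by
  suffices h : w ∉ co4no0.acceptsFrom 0 from h
  induction w with
  | nil => simp [DFA.mem_acceptsFrom, co4no0]
  | cons a w ih =>
    rw [lsd4Value_cons] at hw
    obtain rfl : a = 0 := by ext; simp; omega
    exact mem_acceptsFrom_cons.not.2 (ih (by omega))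

/-- The base 4 digits of `n` as a word. -/
lemma exists_word (n : ℕ) : ∃ w : List (Fin 4), lsd4Value w = n ∧
    nonzeroDigitCount 4 n = w.countP (fun a => a ≠ 0) := by
  have h : ((Nat.digits 4 n).map (Fin.ofNat 4)).map Fin.val = Nat.digits 4 n := by
    rw [List.map_map]
    refine (List.map_congr_left fun a ha => ?_).trans (List.map_id _)
    exact Nat.mod_eq_of_lt (Nat.digits_lt_base (by norm_num) ha)
  refine ⟨(Nat.digits 4 n).map (Fin.ofNat 4), ?_, ?_⟩
  · rw [lsd4Value, h, Nat.ofDigits_digits]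
  · rw [nonzeroDigitCount]
    conv_lhs => rw [← h]
    rw [List.countP_map]
    refine List.countP_congr fun a _ => ?_
    simp only [Function.comp_apply, decide_eq_true_eq, ne_eq, Fin.ext_iff, Fin.val_zero]

end Co4

open Co4 Co4.Code in
theorem mainTheorem3 {K : Type*} [Field K] (hK : Nat.card K = 4) (g : K) (hg : g ^ 2 = g + 1) :
    -- the bound on the number of nonzero base 4 digits of `deg f + 1`
    (∀ b c d : ℕ, NoZeroCoeff (linProd g b c d) →
      nonzeroDigitCount 4 ((linProd g b c d).natDegree + 1) ≤ 4) ∧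
    -- the bound is attained
    ((linProd g 28 35 37).natDegree = 100 ∧
      NoZeroCoeff (linProd g 28 35 37) ∧
      nonzeroDigitCount 4 ((linProd g 28 35 37).natDegree + 1) = 4) ∧
    -- the automaton accepts exactly the numbers `n = b + c + d + 1` that occur
    (∀ w : List (Fin 4), w ∈ co4no0.accepts ↔
      ∃ b c d : ℕ, b + c + d + 1 = lsd4Value w ∧ NoZeroCoeff (linProd g b c d)) := by
  have hempty : ([] : List Code) ∈ units.sublists := by decide
  have sound (w : List (Fin 4)) (b c d : ℕ) (hw : b + c + d + 1 = lsd4Value w)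
      (h : NoZeroCoeff (linProd g b c d)) : w ∈ co4no0.acceptsFrom 0 :=
    mem_acceptsFrom_of_good hK hg w (lines [], 1, 0)
      (List.mem_append_left _ (List.mem_map_of_mem hempty)) b c d
      ((noZeroCoeff_linProd_iff g b c d).1 h) hw
  refine ⟨fun b c d h => ?_, ⟨natDegree_linProd g 28 35 37, ?_, ?_⟩, fun w => ⟨fun hw => ?_, ?_⟩⟩
  · obtain ⟨w, hw, hcount⟩ := exists_word (b + c + d + 1)
    rw [natDegree_linProd, hcount]
    exact countP_le_digitBound (sound w b c d hw.symm h)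
  · rw [noZeroCoeff_linProd_iff]
    exact good_of_forall_notMem (two_eq_zero_of_card hK) hg (by decide +kernel)
  · rw [natDegree_linProd]
    decide +kernel
  · obtain ⟨b, c, d, hn, h⟩ := exists_good_of_mem_acceptsFrom hK hg w
      (fun h => notMem_accepts_of_lsd4Value_eq_zero h hw) [] hempty hw
    exact ⟨b, c, d, hn, (noZeroCoeff_linProd_iff g b c d).2 h⟩
  · rintro ⟨b, c, d, hn, h⟩
    exact sound w b c d hn h
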